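/- Let $2\le d\le n$ be integers and consider the following load balancing system with $n$ servers in discrete time. In each time slot $k\in\mathbb Z_+$, $q_i(k)\in\mathbb Z_+$ is the length of queue $i$ at the beginning of the slot, $a(k)\in\mathbb Z_+$ jobs arrive, a set of $d$ servers is sampled uniformly at random among all sets of $d$ servers, and all the arrivals of the slot are routed to a server $i^*(k)$ with the shortest queue among the sampled ones (ties may be broken by any rule, in particular at random). Then up to $s_i(k)\in\mathbb Z_+$ jobs are served at server $i$, so that $$q_i(k+1)=q_i(k)+a_i(k)-s_i(k)+u_i(k),\qquad q_i(k+1)\,u_i(k)=0,$$ where $a_i(k)=a(k)$ if $i=i^*(k)$ and $a_i(k)=0$ otherwise, and $u_i(k)\in\mathbb Z_+$ is the unused service. The arrivals $\{a(k)\}$ are i.i.d., the potential service vectors $\{\boldsymbol s(k)\}$ are i.i.d. (their components may be dependent), and in each slot $a(k)$, $\boldsymbol s(k)$ and the sampled set are independent of each other and of the past (including $\boldsymbol q(0),\dots,\boldsymbol q(k)$). Fix the law of $\boldsymbol s(0)$, and let $\boldsymbol\mu=\mathbb E[\boldsymbol s(0)]$ and $\mu_\Sigma=\sum_{i=1}^n\mu_i$.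 Suppose that the potential services are bounded, $s_i(0)\le S_{\max}$ almost surely for all $i$, and fix a constant $A_{\max}$. For $\boldsymbol x\in\mathbb R^n$ let $x_{(i)}$ be the $i$-th smallest entry of $\boldsymbol x$, and let $$\mathcal M^{(d)}=\Big\{\boldsymbol x\in\mathbb R_+^n:\ \frac{\sum_{i=1}^j x_{(i)}}{\sum_{i=1}^n x_i}\ge\frac{\binom jd}{\binom nd}\ \text{ for all } d\le j\le n-1\Big\}.$$ Suppose that $\boldsymbol\mu$ lies in the interior of $\mathcal M^{(d)}$ in $\mathbb R^n$, and let $\delta>0$ be such that $$\frac{\sum_{i=1}^j\mu_{(i)}}{\mu_\Sigma}-\delta\ \ge\ \frac{\binom jd}{\binom nd}\qquad\text{for all } d\le j\le n-1 .$$ Then there are finite constants $M_1,M_2,\dots$, which do not depend on $\epsilon$, such that the following holds for every $\epsilon\in(0,\mu_\Sigma)$ with $\epsilon<\delta\mu_\Sigma$ and every such system $\boldsymbol q^{(\epsilon)}$ whose arrivals satisfy $a^{(\epsilon)}(k)\le A_{\max}$ almost surely and $\mathbb E[a^{(\epsilon)}(k)]=\mu_\Sigma-\epsilon$: if $\overline{\boldsymbol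 q}^{(\epsilon)}$ is a steady-state vector, that is, a random vector in $\mathbb Z_+^n$ such that $\boldsymbol q^{(\epsilon)}(k)$ converges in distribution to $\overline{\boldsymbol q}^{(\epsilon)}$ as $k\to\infty$, then $$\mathbb E\big[\|\overline{\boldsymbol q}^{(\epsilon)}_\perp\|^m\big]\le M_m\qquad\text{for all } m=1,2,\dots,$$ where $\|\cdot\|$ is the Euclidean norm, $\boldsymbol x_\perp=\boldsymbol x-\boldsymbol x_\parallel$, and $\boldsymbol x_\parallel=\big(\tfrac1n\sum_{i=1}^n x_i\big)\boldsymbol 1$. -/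

import Mathlib

open MeasureTheory ProbabilityTheory Filter Topology

noncomputable section

namespace LoadBalancing

/-- The sum `x_(1) + ⋯ + x_(j)` of the `j` smallest entries of `x`: `Tuple.sort x` is a permutation
that lists the entries of `x` in nondecreasing order. -/
def sumSmallest {n : ℕ} (x : Fin n → ℝ) (j : ℕ) : ℝ :=
  ∑ i : Fin n with i.val < j, x (Tuple.sort x i)

/-- The polytope `M^(d)` of nonnegative service rate vectors `μ` with
`(μ_(1) + ⋯ + μ_(j)) / μ_Σ ≥ C(j,d) / C(n,d)` for all `d ≤ j ≤ n - 1`. -/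
def polytope (n d : ℕ) : Set (Fin n → ℝ) :=
  {μ | (∀ i, 0 ≤ μ i) ∧ ∀ j : ℕ, d ≤ j → j < n →
    ((j.choose d : ℝ) / (n.choose d : ℝ)) ≤ sumSmallest μ j / ∑ i, μ i}

/-- The mean vector `μ = E[s(1)]` of a potential service vector with law `ν`. -/
def meanService {n : ℕ} (ν : Measure (Fin n → ℕ)) : Fin n → ℝ :=
  fun i => ∫ y, (y i : ℝ) ∂ν

/-- A vector of queue lengths as an element of Euclidean space. -/
def toEuclid {n : ℕ} (q : Fin n → ℕ) : EuclideanSpace ℝ (Fin n) :=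
  WithLp.toLp 2 (fun i => (q i : ℝ))

/-- `x_∥ = 1 · (∑ x_i / n)`. -/
def parallel {n : ℕ} (x : EuclideanSpace ℝ (Fin n)) : EuclideanSpace ℝ (Fin n) :=
  WithLp.toLp 2 (fun _ => (∑ i, x i) / n)

/-- `x_⊥ = x - x_∥`. -/
def perp {n : ℕ} (x : EuclideanSpace ℝ (Fin n)) : EuclideanSpace ℝ (Fin n) :=
  x - parallel x

/-- A load balancing system with `n` servers in discrete time, operating under power-of-`d` choices,
with arrival law `α` and potential service law `ν`. In time slot `k`:
`a k` is the total number of arrivals, `s k` the vector of potential services, `D k` the set of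
sampled servers, `r k` the server to which all the arrivals of the slot are routed, `u k` the
vector of unused services, and `q k` is the vector of queue lengths at the beginning of the slot.
The σ-algebra `ℱ k` is the information available at the beginning of slot `k`. -/
structure IsPowerOfDSystem {n : ℕ} (d : ℕ) (α : Measure ℕ) (ν : Measure (Fin n → ℕ))
    {Ω : Type*} [mΩ : MeasurableSpace Ω] (P : Measure Ω) (ℱ : Filtration ℕ mΩ)
    (a : ℕ → Ω → ℕ) (s : ℕ → Ω → Fin n → ℕ) (D : ℕ → Ω → Finset (Fin n)) (r : ℕ → Ω → Fin n)
    (u q : ℕ → Ω → Fin n → ℕ) : Prop where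
  /-- The queue lengths at the beginning of slot `k` are known at that time. -/
  measurable_queue : ∀ k, Measurable[ℱ k] (q k)
  /-- What happens in slot `k` is known at the beginning of slot `k + 1`. -/
  measurable_arrival : ∀ k, Measurable[ℱ (k + 1)] (a k)
  measurable_service : ∀ k, Measurable[ℱ (k + 1)] (s k)
  measurable_sample : ∀ k, Measurable[ℱ (k + 1)] (D k)
  measurable_route : ∀ k, Measurable[ℱ (k + 1)] (r k)
  /-- The arrivals, the potential services and the sampled set of slot `k` are jointly independent
  of the past. -/
  indep_past : ∀ k, Indep
    (MeasurableSpace.comap (fun ω => (a k ω, s k ω, D k ω)) inferInstance) (ℱ k) P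
  /-- They are independent of each other; `a k` has law `α`, `s k` has law `ν`, and `D k` is
  uniform on the sets of `d` servers. Together with `indep_past` and the measurability conditions,
  this makes each of the three sequences i.i.d. -/
  law : ∀ k, P.map (fun ω => (a k ω, s k ω, D k ω)) =
    α.prod (ν.prod (uniformOn {A : Finset (Fin n) | A.card = d}))
  /-- The arrivals join a shortest queue among the sampled ones. Ties may be broken by any rule,
  in particular at random. -/
  route_mem : ∀ k, ∀ᵐ ω ∂P, r k ω ∈ D k ω ∧ ∀ j ∈ D k ω, q k ω (r k ω) ≤ q k ω j
  /-- `q_i(k+1) = q_i(k) + a_i(k) - s_i(k) + u_i(k)`, where `a_i(k) = a(k)` if the arrivals of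
  slot `k` are routed to server `i` and `a_i(k) = 0` otherwise. -/
  dynamics : ∀ k, ∀ᵐ ω ∂P, ∀ i,
    (q (k + 1) ω i : ℤ) = q k ω i + (if i = r k ω then (a k ω : ℤ) else 0) - s k ω i + u k ω i
  /-- Service is left unused only if the queue is empty afterwards. -/
  unused : ∀ k, ∀ᵐ ω ∂P, ∀ i, q (k + 1) ω i * u k ω i = 0

end LoadBalancing

end

/-!
The proof is a Foster–Lyapunov argument with an exponential test function.

Let `T` be a set of servers. The mean service at `T` is at least the sum of the `|T|` smallest rates, and
a sampled set is contained in `T` with probability `C(|T|,d) / C(n,d)`. So the hypothesis on `δ`, with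
the positivity of all the rates when `|T| < d`, says that every proper nonempty `T` has a spare capacity
of at least some `c > 0` not depending on `ε` (`exists_capacity_slack`). Cutting the queue lengths `q`
into the layers `{i | t < q i}` and adding up these spare capacities gives
`∑ μ_i q_i - λ E[min_{i ∈ D} q_i] ≥ c (max q - min q) + ε min q`, where `λ = μ_Σ - ε` is the arrival rate
(`le_sum_mul_sub_integral_sampledMin`).

If `ε ≤ c / 2`, this makes the mean drift of `‖q_⊥‖` negative, uniformly in `ε`, when `‖q_⊥‖` is large.
For `ε` near its upper limit `δ μ_Σ` the drift of `‖q_⊥‖` may fail to be negative, because a slow server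
with a long queue falls behind the others. But if `ε ≥ c / 2` the mean drift of `‖q‖ ≥ ‖q_⊥‖` is
negative, again uniformly in `ε`. The two cases are treated together with the Lyapunov function
`V = ‖q - τ q_∥‖`, where `τ = 1` or `τ = 0` (`mul_lyapunov_le_drift`); the contribution of the unused
services to the drift of `V²` is bounded (`IsStep.lyapunov_sq_le`).

As the jumps of `V` are bounded, `e^(θ V)` has a geometric drift for small `θ`, hence a bound that is
uniform in time, on the event that the initial queues are bounded (`setLIntegral_exp_le`). It carries
over to the weak limit (`lintegral_exp_limit_le`) and bounds all the moments.
-/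

namespace LoadBalancing

/-! ### Service capacity of subsets of servers -/

theorem sumSmallest_le_sum {n : ℕ} (x : Fin n → ℝ) (T : Finset (Fin n)) (hT : T.card < n) :
    sumSmallest x T.card ≤ ∑ i ∈ T, x i := by
  classical
  set σ := Tuple.sort x with hσ
  have hmono : Monotone (x ∘ σ) := Tuple.monotone_sort x
  set τ : ℝ := x (σ ⟨T.card, hT⟩) with hτ
  have hcard : (Finset.univ.filter fun i : Fin n => i.val < T.card).card = T.card := by
    rw [Fin.card_filter_val_lt]; omega
  -- Both sums have `T.card` terms, so the threshold `τ` can be subtracted from every entry.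
  have h1 : ∑ i : Fin n with i.val < T.card, (x (σ i) - τ)
      = ∑ i : Fin n, min (x (σ i) - τ) 0 := by
    rw [Finset.sum_filter]
    refine Finset.sum_congr rfl fun i _ => ?_
    split_ifs with hi
    · have : x (σ i) ≤ τ := hmono (show i ≤ ⟨T.card, hT⟩ from hi.le)
      rw [min_eq_left (by linarith)]
    · have : τ ≤ x (σ i) := hmono (show (⟨T.card, hT⟩ : Fin n) ≤ i from not_lt.mp hi)
      rw [min_eq_right (by linarith)]
  have h2 : ∑ i : Fin n, min (x (σ i) - τ) 0 = ∑ i : Fin n, min (x i - τ) 0 :=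
    Equiv.sum_comp σ fun i => min (x i - τ) 0
  have h3 : ∑ i : Fin n, min (x i - τ) 0 ≤ ∑ i ∈ T, min (x i - τ) 0 := by
    rw [← Finset.sum_add_sum_compl T]
    have : ∑ i ∈ Tᶜ, min (x i - τ) 0 ≤ 0 := Finset.sum_nonpos fun i _ => min_le_right _ _
    linarith
  have h4 : ∑ i ∈ T, min (x i - τ) 0 ≤ ∑ i ∈ T, (x i - τ) :=
    Finset.sum_le_sum fun i _ => min_le_left _ _
  rw [Finset.sum_sub_distrib, Finset.sum_const, nsmul_eq_mul] at h1 h4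
  rw [hcard] at h1
  unfold sumSmallest
  linarith

/-- A point with a zero entry is on the boundary: decreasing that entry leaves the polytope. -/
theorem pos_of_mem_interior_polytope {n d : ℕ} {x : Fin n → ℝ}
    (hx : x ∈ interior (polytope n d)) (i : Fin n) : 0 < x i := by
  have hc : Continuous fun τ : ℝ => Function.update x i τ := continuous_const.update i continuous_id
  have hmem : ∀ᶠ τ in 𝓝 (x i), Function.update x i τ ∈ interior (polytope n d) :=
    hc.continuousAt.eventually (isOpen_interior.mem_nhds (by simpa using hx))
  obtain ⟨τ, hτ, hτi⟩ := ((hmem.filter_mono nhdsWithin_le_nhds).and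
    (self_mem_nhdsWithin : Set.Iio (x i) ∈ 𝓝[<] (x i))).exists
  have := (interior_subset hτ).1 i
  rw [Function.update_self] at this
  exact this.trans_lt hτi

/-- Every proper nonempty set `T` of servers has service capacity exceeding, by a margin `c` that is
uniform in the arrival rate `lam`, the rate of the arrivals for which only servers in `T` are sampled.
If `T` has fewer than `d` servers that rate is `0`, and the margin is the least service rate. -/
theorem exists_capacity_slack {n d : ℕ} (hn : 0 < n) {w : Fin n → ℝ} (hw : ∀ i, 0 < w i)
    {δ : ℝ} (hδ : 0 < δ)
    (hslack : ∀ j : ℕ, d ≤ j → j < n →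
      (j.choose d : ℝ) / (n.choose d : ℝ) ≤ sumSmallest w j / (∑ i, w i) - δ) :
    ∃ c, 0 < c ∧ ∀ lam ≤ ∑ i, w i, ∀ T : Finset (Fin n), T.Nonempty → T.card < n →
      c ≤ ∑ i ∈ T, w i - lam * ((T.card.choose d : ℝ) / (n.choose d : ℝ)) := by
  have : Nonempty (Fin n) := ⟨⟨0, hn⟩⟩
  obtain ⟨i₀, hi₀⟩ := Finite.exists_min w
  have hsum : 0 < ∑ i, w i := Finset.sum_pos (fun i _ => hw i) Finset.univ_nonempty
  refine ⟨min (δ * ∑ i, w i) (w i₀), lt_min (mul_pos hδ hsum) (hw i₀), fun lam hlam T hT hTn => ?_⟩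
  rcases lt_or_ge T.card d with hTd | hTd
  · rw [Nat.choose_eq_zero_of_lt hTd]
    obtain ⟨i, hi⟩ := hT
    have := Finset.single_le_sum (f := w) (fun j _ => (hw j).le) hi
    refine (min_le_right _ _).trans ?_
    simpa using (hi₀ i).trans this
  · have h1 := hslack _ hTd hTn
    have h2 := sumSmallest_le_sum w T hTn
    rw [le_sub_iff_add_le, le_div_iff₀ hsum] at h1
    have h3 : lam * ((T.card.choose d : ℝ) / (n.choose d : ℝ))
        ≤ (∑ i, w i) * ((T.card.choose d : ℝ) / (n.choose d : ℝ)) := by gcongr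
    refine (min_le_left _ _).trans ?_
    linarith

/-! ### Queue lengths by layers, and the mean shortest sampled queue -/

/-- The set of servers whose queue is longer than `t`. -/
def level {n : ℕ} (v : Fin n → ℕ) (t : ℕ) : Finset (Fin n) := {i | t < v i}

theorem mem_level {n : ℕ} {v : Fin n → ℕ} {t : ℕ} {i : Fin n} : i ∈ level v t ↔ t < v i := by
  simp [level]

/-- The shortest queue length `min_{i ∈ D} v i` among the servers in `D`, counted by layers: it is
the number of `t` such that all queues in `D` are longer than `t`. The bound `∑ i, v i` on `t` only
serves to make the count finite, so the value at `D = ∅` has no meaning. -/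
def sampledMin {n : ℕ} (v : Fin n → ℕ) (D : Finset (Fin n)) : ℕ :=
  ((Finset.range (∑ i, v i)).filter fun t => D ⊆ level v t).card

theorem eq_sampledMin {n : ℕ} {v : Fin n → ℕ} {D : Finset (Fin n)} {r : Fin n} (hr : r ∈ D)
    (hmin : ∀ j ∈ D, v r ≤ v j) : v r = sampledMin v D := by
  have hle : v r ≤ ∑ i, v i :=
    Finset.single_le_sum (fun i _ => Nat.zero_le (v i)) (Finset.mem_univ r)
  have : (Finset.range (∑ i, v i)).filter (fun t => D ⊆ level v t) = Finset.range (v r) := by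
    ext t
    rw [Finset.mem_filter, Finset.mem_range, Finset.mem_range]
    refine ⟨fun h => mem_level.mp (h.2 hr), fun ht => ⟨by omega, fun j hj => ?_⟩⟩
    exact mem_level.mpr (ht.trans_le (hmin j hj))
  rw [sampledMin, this, Finset.card_range]

/-- Layer-cake formula for a weighted sum of the queue lengths. -/
theorem sum_mul_eq_sum_level {n : ℕ} (w : Fin n → ℝ) (v : Fin n → ℕ) :
    ∑ i, w i * v i = ∑ t ∈ Finset.range (∑ i, v i), ∑ i ∈ level v t, w i := by
  simp only [level, Finset.sum_filter]
  rw [Finset.sum_comm]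
  refine Finset.sum_congr rfl fun i _ => ?_
  have hle : v i ≤ ∑ i, v i :=
    Finset.single_le_sum (fun i _ => Nat.zero_le (v i)) (Finset.mem_univ i)
  have : (Finset.range (∑ i, v i)).filter (fun t => t < v i) = Finset.range (v i) := by
    ext t; simp only [Finset.mem_filter, Finset.mem_range]; omega
  rw [← Finset.sum_filter, this, Finset.sum_const, Finset.card_range, nsmul_eq_mul, mul_comm]

/-- The law of the sampled set. -/
noncomputable abbrev sampleLaw (n d : ℕ) : Measure (Finset (Fin n)) :=
  uniformOn {A : Finset (Fin n) | A.card = d}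

theorem isProbabilityMeasure_sampleLaw {n d : ℕ} (hdn : d ≤ n) :
    IsProbabilityMeasure (sampleLaw n d) := by
  refine isProbabilityMeasure_uniformOn (Set.toFinite _) ?_
  obtain ⟨A, -, hA⟩ := Finset.exists_subset_card_eq (s := (Finset.univ : Finset (Fin n))) (n := d)
    (by simpa using hdn)
  exact ⟨A, hA⟩

theorem sampleLaw_real_subset {n d : ℕ} (T : Finset (Fin n)) :
    (sampleLaw n d).real {D | D ⊆ T} = (T.card.choose d : ℝ) / (n.choose d : ℝ) := by
  classical
  have h1 : {A : Finset (Fin n) | A.card = d}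
      = ((Finset.univ.powersetCard d : Finset (Finset (Fin n))) : Set (Finset (Fin n))) := by
    ext A; simp
  have h2 : {D : Finset (Fin n) | D ⊆ T} = ((T.powerset : Finset (Finset (Fin n))) : Set _) := by
    ext A; simp
  have h3 : (Finset.univ.powersetCard d : Finset (Finset (Fin n))) ∩ T.powerset
      = T.powersetCard d := by
    ext A; simp [Finset.mem_powersetCard, and_comm]
  rw [measureReal_def, sampleLaw, h1, h2, uniformOn_apply_finset, h3]
  simp

theorem integral_sampledMin {n d : ℕ} (hdn : d ≤ n) (v : Fin n → ℕ) :
    ∫ D, (sampledMin v D : ℝ) ∂(sampleLaw n d)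
      = ∑ t ∈ Finset.range (∑ i, v i), ((level v t).card.choose d : ℝ) / (n.choose d : ℝ) := by
  have := isProbabilityMeasure_sampleLaw hdn
  have : ∀ D, (sampledMin v D : ℝ)
      = ∑ t ∈ Finset.range (∑ i, v i), Set.indicator {D | D ⊆ level v t} (fun _ => (1 : ℝ)) D := by
    intro D
    rw [sampledMin, Finset.card_filter, Nat.cast_sum]
    refine Finset.sum_congr rfl fun t _ => ?_
    by_cases h : D ⊆ level v t <;> simp [h]
  simp_rw [this]
  rw [integral_finsetSum _ fun t _ => Integrable.of_finite]
  refine Finset.sum_congr rfl fun t _ => ?_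
  rw [integral_indicator (MeasurableSet.of_discrete), setIntegral_const, smul_eq_mul, mul_one,
    sampleLaw_real_subset]

/-- If every proper nonempty set of servers has spare capacity at least `c`, and all servers together
have spare capacity `ε`, then the mean service weighted by the queue lengths exceeds the mean arrival
weighted by the shortest sampled queue. Summing over the layers `t`, the layers below the shortest
queue contribute `ε` each, and those between the shortest and the longest queue at least `c` each. -/
theorem le_sum_mul_sub_integral_sampledMin {n d : ℕ} (hd : 0 < d) (hdn : d ≤ n) {w : Fin n → ℝ}
    {lam ε c : ℝ} (hsum : ∑ i, w i = lam + ε)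
    (hcap : ∀ T : Finset (Fin n), T.Nonempty → T.card < n →
      c ≤ ∑ i ∈ T, w i - lam * ((T.card.choose d : ℝ) / (n.choose d : ℝ)))
    (v : Fin n → ℕ) {i₀ i₁ : Fin n} (h₀ : ∀ i, v i₀ ≤ v i) (h₁ : ∀ i, v i ≤ v i₁) :
    c * ((v i₁ : ℝ) - v i₀) + ε * v i₀
      ≤ ∑ i, w i * v i - lam * ∫ D, (sampledMin v D : ℝ) ∂(sampleLaw n d) := by
  rw [integral_sampledMin hdn, sum_mul_eq_sum_level, Finset.mul_sum, ← Finset.sum_sub_distrib]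
  have hN : v i₁ ≤ ∑ i, v i :=
    Finset.single_le_sum (fun i _ => Nat.zero_le (v i)) (Finset.mem_univ i₁)
  have hlo : v i₀ ≤ v i₁ := h₀ i₁
  have hterm : ∀ t, (if t < v i₁ then c else 0) + (if t < v i₀ then ε - c else 0)
      ≤ ∑ i ∈ level v t, w i - lam * (((level v t).card.choose d : ℝ) / (n.choose d : ℝ)) := by
    intro t
    by_cases ht₀ : t < v i₀
    · have hl : level v t = Finset.univ := by
        ext i; simpa [level] using ht₀.trans_le (h₀ i)
      have hn : ((n.choose d : ℕ) : ℝ) ≠ 0 := by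
        exact_mod_cast (Nat.choose_pos hdn).ne'
      rw [if_pos (ht₀.trans_le hlo), if_pos ht₀, hl, hsum, Finset.card_univ, Fintype.card_fin,
        div_self hn]
      linarith
    · rw [if_neg ht₀]
      by_cases ht₁ : t < v i₁
      · rw [if_pos ht₁, add_zero]
        refine hcap _ ⟨i₁, by simpa [level] using ht₁⟩ ?_
        have : level v t ⊂ Finset.univ :=
          Finset.ssubset_univ_iff.mpr fun h => ht₀ (by
            have := h ▸ Finset.mem_univ i₀
            simpa [level] using this)
        simpa using Finset.card_lt_card this
      · have hl : level v t = ∅ := by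
          ext i
          have := h₁ i
          simp only [level, Finset.mem_filter_univ, Finset.notMem_empty, iff_false]
          omega
        rw [if_neg ht₁, hl, Finset.card_empty, Nat.choose_eq_zero_of_lt hd]
        simp
  refine le_trans (le_of_eq ?_) (Finset.sum_le_sum fun t _ => hterm t)
  have hf : ∀ m, m ≤ ∑ i, v i →
      (Finset.range (∑ i, v i)).filter (fun t => t < m) = Finset.range m := by
    intro m hm; ext t; simp only [Finset.mem_filter, Finset.mem_range]; omega
  rw [Finset.sum_add_distrib, ← Finset.sum_filter, ← Finset.sum_filter, hf _ hN,
    hf _ (hlo.trans hN)]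
  simp only [Finset.sum_const, Finset.card_range, nsmul_eq_mul]
  ring

/-! ### The Lyapunov functions -/

/-- The deviation `x - τ x_∥`. Only `τ = 0`, which gives `x`, and `τ = 1`, which gives `x_⊥`, are
used: they are the values for which it is an orthogonal projection. -/
noncomputable def recenter {n : ℕ} (τ : ℝ) (x : EuclideanSpace ℝ (Fin n)) :
    EuclideanSpace ℝ (Fin n) :=
  x - τ • parallel x

theorem recenter_apply {n : ℕ} (τ : ℝ) (x : EuclideanSpace ℝ (Fin n)) (i : Fin n) :
    recenter τ x i = x i - τ * ((∑ j, x j) / n) := rfl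

theorem recenter_add {n : ℕ} (τ : ℝ) (x y : EuclideanSpace ℝ (Fin n)) :
    recenter τ (x + y) = recenter τ x + recenter τ y := by
  ext i
  simp only [recenter_apply, PiLp.add_apply, Finset.sum_add_distrib]
  ring

theorem recenter_eq_add {n : ℕ} (τ : ℝ) (x y : EuclideanSpace ℝ (Fin n)) :
    recenter τ y = recenter τ x + recenter τ (y - x) := by
  rw [← recenter_add, add_sub_cancel]

/-- `recenter τ` is an orthogonal projection if `τ` is `0` or `1`. -/
theorem inner_recenter {n : ℕ} {τ : ℝ} (hτ : τ * τ = τ) (x y : EuclideanSpace ℝ (Fin n)) :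
    inner ℝ (recenter τ x) (recenter τ y) = ∑ i, recenter τ x i * y i := by
  have h : ∀ z : EuclideanSpace ℝ (Fin n), ∑ _j : Fin n, (∑ i, z i) / (n : ℝ) = ∑ i, z i := by
    intro z
    rcases n.eq_zero_or_pos with rfl | hn
    · simp
    · rw [Finset.sum_const, Finset.card_univ, Fintype.card_fin, nsmul_eq_mul]
      field_simp
  have hs : ∑ i, recenter τ x i = (1 - τ) * ∑ i, x i := by
    simp only [recenter_apply, Finset.sum_sub_distrib, ← Finset.mul_sum, h]
    ring
  have : inner ℝ (recenter τ x) (recenter τ y)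
      = ∑ i, recenter τ x i * y i - (∑ i, recenter τ x i) * (τ * ((∑ j, y j) / n)) := by
    rw [PiLp.inner_apply, Finset.sum_mul, ← Finset.sum_sub_distrib]
    refine Finset.sum_congr rfl fun i _ => ?_
    rw [recenter_apply τ y]
    simp only [RCLike.inner_apply, conj_trivial]
    ring
  rw [this, hs]
  linear_combination (∑ i, x i) * ((∑ j, y j) / n) * hτ

theorem norm_recenter_le {n : ℕ} {τ : ℝ} (hτ : τ * τ = τ) (x : EuclideanSpace ℝ (Fin n)) :
    ‖recenter τ x‖ ≤ ‖x‖ := by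
  have h1 : ‖recenter τ x‖ * ‖recenter τ x‖ ≤ ‖recenter τ x‖ * ‖x‖ := by
    rw [← real_inner_self_eq_norm_mul_norm, inner_recenter hτ]
    refine le_trans (le_of_eq ?_) (real_inner_le_norm (recenter τ x) x)
    rw [PiLp.inner_apply]
    refine Finset.sum_congr rfl fun i _ => ?_
    simp only [RCLike.inner_apply, conj_trivial]
    ring
  by_contra! h
  nlinarith [norm_nonneg x, norm_nonneg (recenter τ x)]

theorem norm_le_of_forall_abs_le {n : ℕ} {x : EuclideanSpace ℝ (Fin n)} {C : ℝ} (hC : 0 ≤ C)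
    (hx : ∀ i, |x i| ≤ C) : ‖x‖ ≤ n * C := by
  rw [EuclideanSpace.norm_eq, Real.sqrt_le_left (by positivity)]
  calc ∑ i, ‖x i‖ ^ 2 ≤ ∑ _i : Fin n, C ^ 2 := by
        refine Finset.sum_le_sum fun i _ => ?_
        rw [Real.norm_eq_abs]
        exact pow_le_pow_left₀ (abs_nonneg _) (hx i) 2
    _ = n * C ^ 2 := by simp
    _ ≤ (n * C) ^ 2 := by
        have : (n : ℝ) ≤ n ^ 2 := by exact_mod_cast Nat.le_self_pow two_ne_zero n
        nlinarith [sq_nonneg C]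

/-- The Lyapunov function: `‖q‖` for `τ = 0`, and `‖q_⊥‖` for `τ = 1`. -/
noncomputable def lyapunov {n : ℕ} (τ : ℝ) (v : Fin n → ℕ) : ℝ := ‖recenter τ (toEuclid v)‖

/-- The shift `τ (∑ v_i / n)` by which `recenter τ` moves all the entries of `v`. -/
noncomputable def shift {n : ℕ} (τ : ℝ) (v : Fin n → ℕ) : ℝ := τ * ((∑ i, (v i : ℝ)) / n)

theorem norm_perp_le_lyapunov {n : ℕ} {τ : ℝ} (hτ : τ = 0 ∨ τ = 1) (v : Fin n → ℕ) :
    ‖perp (toEuclid v)‖ ≤ lyapunov τ v := by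
  have h1 : perp (toEuclid v) = recenter 1 (toEuclid v) := by
    rw [recenter, one_smul, perp]
  rw [h1]
  rcases hτ with rfl | rfl
  · refine (norm_recenter_le (one_mul 1) _).trans_eq ?_
    rw [lyapunov, recenter, zero_smul, sub_zero]
  · exact le_rfl

/-! ### One slot -/

/-- The part of `⟨recenter τ v, v' - v⟩` that the events `p = (a, s, D)` of the slot determine: the
arrivals `a` join a queue of length `sampledMin v D`, and `s` are the potential services. -/
noncomputable def increment {n : ℕ} (τ : ℝ) (v : Fin n → ℕ)
    (p : ℕ × (Fin n → ℕ) × Finset (Fin n)) : ℝ :=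
  p.1 * (sampledMin v p.2.2 - shift τ v) - ∑ i, (v i - shift τ v) * p.2.1 i

/-- A bound on the Euclidean norm of the change of the queue lengths in a slot; the summand `1` makes
it positive. -/
noncomputable def jumpBound (n Amax Smax : ℕ) : ℝ := n * (Amax + Smax) + 1

/-- A transition from the queue lengths `v` to `v'` in a slot with arrivals, potential services and
sampled set `p = (a, s, D)`, routing to server `r`, and unused services `u`, with at most `Amax` arrivals and at
most `Smax` potential services per server. -/
structure IsStep {n : ℕ} (Amax Smax : ℕ) (v v' : Fin n → ℕ)
    (p : ℕ × (Fin n → ℕ) × Finset (Fin n)) (r : Fin n) (u : Fin n → ℕ) : Prop where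
  arrival_le : p.1 ≤ Amax
  service_le : ∀ i, p.2.1 i ≤ Smax
  route_mem : r ∈ p.2.2
  route_le : ∀ j ∈ p.2.2, v r ≤ v j
  dynamics : ∀ i, (v' i : ℤ) = v i + (if i = r then (p.1 : ℤ) else 0) - p.2.1 i + u i
  unused : ∀ i, v' i * u i = 0

namespace IsStep

variable {n Amax Smax : ℕ} {v v' u : Fin n → ℕ} {p : ℕ × (Fin n → ℕ) × Finset (Fin n)} {r : Fin n}

theorem unused_le (h : IsStep Amax Smax v v' p r u) (i : Fin n) : u i ≤ p.2.1 i := by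
  have h1 := h.dynamics i
  rcases mul_eq_zero.mp (h.unused i) with h2 | h2
  · split_ifs at h1 <;> omega
  · omega

/-- Service is unused only at queues that were already at most `Smax`. -/
theorem mul_unused_le (h : IsStep Amax Smax v v' p r u) (i : Fin n) : v i * u i ≤ Smax * Smax := by
  have h1 := h.dynamics i
  have h3 := h.service_le i
  have h4 := h.unused_le i
  rcases mul_eq_zero.mp (h.unused i) with h2 | h2
  · refine Nat.mul_le_mul ?_ (by omega)
    split_ifs at h1 <;> omega
  · simp [h2]

theorem norm_sub_le (h : IsStep Amax Smax v v' p r u) :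
    ‖toEuclid v' - toEuclid v‖ ≤ jumpBound n Amax Smax := by
  refine (norm_le_of_forall_abs_le (C := Amax + Smax) (by positivity) fun i => ?_).trans
    (by unfold jumpBound; linarith)
  have h1 := h.dynamics i
  have h2 := h.service_le i
  have h3 := h.unused_le i
  have h4 := h.arrival_le
  have h5 : |(v' i : ℤ) - v i| ≤ Amax + Smax := by
    rw [abs_le]; split_ifs at h1 <;> constructor <;> omega
  have : (toEuclid v' - toEuclid v) i = (((v' i : ℤ) - v i : ℤ) : ℝ) := by
    simp [toEuclid]
  rw [this, ← Int.cast_abs]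
  refine (Int.cast_le.mpr h5).trans_eq ?_
  push_cast
  rfl

theorem abs_lyapunov_sub_le (h : IsStep Amax Smax v v' p r u) {τ : ℝ} (hτ : τ * τ = τ) :
    |lyapunov τ v' - lyapunov τ v| ≤ jumpBound n Amax Smax := by
  refine (abs_norm_sub_norm_le _ _).trans ?_
  rw [recenter_eq_add τ (toEuclid v) (toEuclid v'), add_sub_cancel_left]
  exact (norm_recenter_le hτ _).trans h.norm_sub_le

/-- The unused services enter only through the bounded terms `v i * u i`, because the shift has the
favourable sign. -/
theorem lyapunov_sq_le (h : IsStep Amax Smax v v' p r u) {τ : ℝ} (hτ : τ * τ = τ) (hτ0 : 0 ≤ τ) :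
    lyapunov τ v' ^ 2 ≤ lyapunov τ v ^ 2 + 2 * increment τ v p
      + (2 * n * Smax ^ 2 + jumpBound n Amax Smax ^ 2) := by
  set z := toEuclid v' - toEuclid v with hz
  have h1 : lyapunov τ v' ^ 2 = lyapunov τ v ^ 2
      + 2 * ∑ i, (v i - shift τ v) * z i + ‖recenter τ z‖ ^ 2 := by
    have := inner_recenter hτ (toEuclid v) z
    unfold lyapunov
    rw [recenter_eq_add τ (toEuclid v) (toEuclid v'), norm_add_sq_real, this]
    rfl
  have h2 : ‖recenter τ z‖ ^ 2 ≤ jumpBound n Amax Smax ^ 2 :=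
    pow_le_pow_left₀ (norm_nonneg _) ((norm_recenter_le hτ _).trans h.norm_sub_le) 2
  have hb : 0 ≤ shift τ v := by unfold shift; positivity
  have h3 : ∀ i, (v i - shift τ v) * z i
      ≤ (if i = r then (p.1 : ℝ) * (v i - shift τ v) else 0)
        - (v i - shift τ v) * p.2.1 i + Smax ^ 2 := by
    intro i
    have hzi : z i = (if i = r then (p.1 : ℝ) else 0) - p.2.1 i + u i := by
      have : ((v' i : ℤ) : ℝ) = ((v i + (if i = r then (p.1 : ℤ) else 0) - p.2.1 i + u i : ℤ) : ℝ) :=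
        congrArg _ (h.dynamics i)
      have hz' : z i = (v' i : ℝ) - v i := rfl
      rw [hz']
      push_cast at this
      linarith
    have hu : (v i : ℝ) * u i ≤ Smax ^ 2 := by
      rw [sq]; exact_mod_cast h.mul_unused_le i
    have hbu : 0 ≤ shift τ v * u i := by positivity
    rw [hzi]
    split_ifs <;> nlinarith
  have h4 := Finset.sum_le_sum fun i (_ : i ∈ Finset.univ) => h3 i
  rw [Finset.sum_add_distrib, Finset.sum_sub_distrib, Finset.sum_ite_eq' Finset.univ r] at h4
  simp only [Finset.mem_univ, if_true, Finset.sum_const, Finset.card_univ, Fintype.card_fin,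
    nsmul_eq_mul] at h4
  have h5 : (v r : ℝ) = sampledMin v p.2.2 := by
    exact_mod_cast eq_sampledMin h.route_mem h.route_le
  rw [h5] at h4
  unfold increment
  linarith

/-- The exponential of the Lyapunov function is bounded by its second-order expansion. Since
`V' - V ≤ (V'² - V²) / (2 V)`, the first-order term can be written with `increment`. -/
theorem exp_lyapunov_le (h : IsStep Amax Smax v v' p r u) {τ : ℝ} (hτ : τ * τ = τ) (hτ0 : 0 ≤ τ)
    {θ : ℝ} (hθ : 0 ≤ θ) (hθB : θ * jumpBound n Amax Smax ≤ 1) (hV : 0 < lyapunov τ v) :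
    Real.exp (θ * lyapunov τ v') ≤ Real.exp (θ * lyapunov τ v) *
      (1 + θ * ((2 * increment τ v p + (2 * n * Smax ^ 2 + jumpBound n Amax Smax ^ 2))
        / (2 * lyapunov τ v)) + (θ * jumpBound n Amax Smax) ^ 2) := by
  set Δ := lyapunov τ v' - lyapunov τ v with hΔ
  have hΔB : |Δ| ≤ jumpBound n Amax Smax := h.abs_lyapunov_sub_le hτ
  have h1 : |θ * Δ| ≤ θ * jumpBound n Amax Smax := by
    rw [abs_mul, abs_of_nonneg hθ]
    exact mul_le_mul_of_nonneg_left hΔB hθ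
  have h2 : Real.exp (θ * Δ) ≤ 1 + θ * Δ + (θ * Δ) ^ 2 := by
    have := (abs_le.mp (Real.abs_exp_sub_one_sub_id_le (h1.trans hθB))).2
    linarith
  have h3 : (θ * Δ) ^ 2 ≤ (θ * jumpBound n Amax Smax) ^ 2 := by
    rw [← sq_abs (θ * Δ)]
    exact pow_le_pow_left₀ (abs_nonneg _) h1 2
  have h4 : Δ ≤ (2 * increment τ v p + (2 * n * Smax ^ 2 + jumpBound n Amax Smax ^ 2))
      / (2 * lyapunov τ v) := by
    rw [le_div_iff₀ (by positivity)]
    nlinarith [h.lyapunov_sq_le hτ hτ0, sq_nonneg Δ]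
  have h5 : Real.exp (θ * lyapunov τ v') = Real.exp (θ * lyapunov τ v) * Real.exp (θ * Δ) := by
    rw [← Real.exp_add]; congr 1; rw [hΔ]; ring
  rw [h5]
  refine mul_le_mul_of_nonneg_left ?_ (Real.exp_pos _).le
  have := mul_le_mul_of_nonneg_left h4 hθ
  linarith

end IsStep

/-! ### The mean drift -/

/-- Negative mean drift of `V = lyapunov τ`, proportional to `V`. The right-hand side is minus the mean
of `increment τ v`. With `τ = 1` it is at least `(c - ε)` times the difference of the longest and the
shortest queue, which is enough for small `ε`. With `τ = 0` it is at least `min c ε` times the longest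
queue, which is enough for the other `ε`. -/
theorem mul_lyapunov_le_drift {n d : ℕ} (hd : 0 < d) (hdn : d ≤ n) {w : Fin n → ℝ}
    {lam ε c : ℝ} (hε : 0 ≤ ε) (hc : 0 < c) (hsum : ∑ i, w i = lam + ε)
    (hcap : ∀ T : Finset (Fin n), T.Nonempty → T.card < n →
      c ≤ ∑ i ∈ T, w i - lam * ((T.card.choose d : ℝ) / (n.choose d : ℝ))) {τ : ℝ}
    (hτ : τ = 0 ∧ c / 2 ≤ ε ∨ τ = 1 ∧ ε ≤ c / 2) (v : Fin n → ℕ) :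
    c / (2 * n) * lyapunov τ v ≤ ∑ i, (v i - shift τ v) * w i
      - lam * (∫ D, (sampledMin v D : ℝ) ∂(sampleLaw n d) - shift τ v) := by
  have hn : 0 < n := hd.trans_le hdn
  have : Nonempty (Fin n) := ⟨⟨0, hn⟩⟩
  have hn' : (0 : ℝ) < n := by exact_mod_cast hn
  obtain ⟨i₀, h₀⟩ := Finite.exists_min v
  obtain ⟨i₁, h₁⟩ := Finite.exists_max v
  have key := le_sum_mul_sub_integral_sampledMin hd hdn hsum hcap v h₀ h₁
  set lo : ℝ := (v i₀ : ℝ) with hlo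
  set hi : ℝ := (v i₁ : ℝ) with hhi
  have hlo' : ∀ i, lo ≤ v i := fun i => Nat.cast_le.mpr (h₀ i)
  have hhi' : ∀ i, (v i : ℝ) ≤ hi := fun i => Nat.cast_le.mpr (h₁ i)
  have hlo0 : 0 ≤ lo := Nat.cast_nonneg _
  have hlohi : lo ≤ hi := hlo' i₁
  have e1 : ∑ i, ((v i : ℝ) - shift τ v) * w i = ∑ i, w i * v i - shift τ v * (lam + ε) := by
    rw [← hsum, Finset.mul_sum, ← Finset.sum_sub_distrib]
    exact Finset.sum_congr rfl fun i _ => by ring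
  rw [e1]
  suffices h : c / (2 * n) * lyapunov τ v ≤ c * (hi - lo) + ε * (lo - shift τ v) by linarith
  have hnorm : ∀ C, 0 ≤ C → (∀ i, |v i - shift τ v| ≤ C) →
      c / (2 * n) * lyapunov τ v ≤ c / 2 * C := by
    intro C hC hvC
    have : lyapunov τ v ≤ n * C := norm_le_of_forall_abs_le hC hvC
    calc c / (2 * n) * lyapunov τ v ≤ c / (2 * n) * (n * C) := by gcongr
      _ = c / 2 * C := by field_simp
  rcases hτ with ⟨rfl, hε'⟩ | ⟨rfl, hε'⟩
  · have hs : shift 0 v = 0 := by simp [shift]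
    rw [hs]
    refine (hnorm hi (hlo0.trans hlohi) fun i => ?_).trans ?_
    · rw [hs, sub_zero, abs_of_nonneg (Nat.cast_nonneg _)]
      exact hhi' i
    · nlinarith
  · have hs : shift 1 v * n = ∑ i, (v i : ℝ) := by
      unfold shift; field_simp
    have hs1 : lo ≤ shift 1 v := by
      have := Finset.sum_le_sum fun i (_ : i ∈ Finset.univ) => hlo' i
      rw [Finset.sum_const, Finset.card_univ, Fintype.card_fin, nsmul_eq_mul, ← hs] at this
      exact le_of_mul_le_mul_left (by linarith) hn'
    have hs2 : shift 1 v ≤ hi := by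
      have := Finset.sum_le_sum fun i (_ : i ∈ Finset.univ) => hhi' i
      rw [Finset.sum_const, Finset.card_univ, Fintype.card_fin, nsmul_eq_mul, ← hs] at this
      exact le_of_mul_le_mul_left (by linarith) hn'
    refine (hnorm (hi - lo) (by linarith) fun i => ?_).trans ?_
    · have := hlo' i
      have := hhi' i
      rw [abs_le]; constructor <;> linarith
    · nlinarith

/-! ### The law of a slot and independence of the past -/

/-- The joint law of the arrivals, the potential services and the sampled set of a slot. -/
noncomputable abbrev slotLaw {n : ℕ} (d : ℕ) (α : Measure ℕ) (ν : Measure (Fin n → ℕ)) :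
    Measure (ℕ × (Fin n → ℕ) × Finset (Fin n)) :=
  α.prod (ν.prod (sampleLaw n d))

section SlotLaw

variable {n d : ℕ} {α : Measure ℕ} {ν : Measure (Fin n → ℕ)} {Amax Smax : ℕ}

theorem ae_slotLaw (hdn : d ≤ n) (hA : ∀ᵐ x ∂α, x ≤ Amax) (hS : ∀ᵐ y ∂ν, ∀ i, y i ≤ Smax) :
    ∀ᵐ p ∂(slotLaw d α ν), p.1 ≤ Amax ∧ ∀ i, p.2.1 i ≤ Smax := by
  have := isProbabilityMeasure_sampleLaw hdn
  have h1 : ∀ᵐ p ∂(slotLaw d α ν), p.1 ≤ Amax :=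
    Measure.quasiMeasurePreserving_fst.ae hA
  have h2 : ∀ᵐ p ∂(slotLaw d α ν), ∀ i, p.2.1 i ≤ Smax :=
    (Measure.quasiMeasurePreserving_fst.comp Measure.quasiMeasurePreserving_snd).ae hS
  filter_upwards [h1, h2] with p hp1 hp2 using ⟨hp1, hp2⟩

variable [IsProbabilityMeasure α] [IsProbabilityMeasure ν]

theorem integrable_arrival (hA : ∀ᵐ x ∂α, x ≤ Amax) : Integrable (fun x : ℕ => (x : ℝ)) α := by
  refine Integrable.of_bound (Measurable.of_discrete.aestronglyMeasurable) Amax ?_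
  filter_upwards [hA] with x hx
  rw [Real.norm_of_nonneg (Nat.cast_nonneg _)]
  exact_mod_cast hx

theorem integrable_service (hS : ∀ᵐ y ∂ν, ∀ i, y i ≤ Smax) (i : Fin n) :
    Integrable (fun y : Fin n → ℕ => (y i : ℝ)) ν := by
  refine Integrable.of_bound (Measurable.of_discrete.aestronglyMeasurable) Smax ?_
  filter_upwards [hS] with y hy
  rw [Real.norm_of_nonneg (Nat.cast_nonneg _)]
  exact_mod_cast hy i

theorem integrable_increment_and_integral (hdn : d ≤ n) (hA : ∀ᵐ x ∂α, x ≤ Amax)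
    (hS : ∀ᵐ y ∂ν, ∀ i, y i ≤ Smax) (τ : ℝ) (v : Fin n → ℕ) :
    Integrable (increment τ v) (slotLaw d α ν) ∧
    ∫ p, increment τ v p ∂(slotLaw d α ν)
      = (∫ x, (x : ℝ) ∂α) * (∫ D, (sampledMin v D : ℝ) ∂(sampleLaw n d) - shift τ v)
        - ∑ i, (v i - shift τ v) * meanService ν i := by
  have := isProbabilityMeasure_sampleLaw hdn
  have i1 : Integrable (fun D : Finset (Fin n) => (sampledMin v D - shift τ v : ℝ))
      (sampleLaw n d) := Integrable.of_finite
  have i2 : Integrable (fun p : ℕ × (Fin n → ℕ) × Finset (Fin n) =>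
      (p.1 : ℝ) * (sampledMin v p.2.2 - shift τ v)) (slotLaw d α ν) :=
    (integrable_arrival hA).mul_prod (i1.comp_snd ν)
  have i3 : ∀ i, Integrable (fun p : ℕ × (Fin n → ℕ) × Finset (Fin n) =>
      (v i - shift τ v) * (p.2.1 i : ℝ)) (slotLaw d α ν) := fun i =>
    (((integrable_service hS i).comp_fst (sampleLaw n d)).comp_snd α).const_mul _
  have i4 := integrable_finsetSum Finset.univ fun i _ => i3 i
  refine ⟨i2.sub i4, ?_⟩
  unfold increment
  rw [integral_sub i2 i4, integral_finsetSum _ fun i _ => i3 i]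
  congr 1
  · rw [integral_prod_mul (fun x : ℕ => (x : ℝ))
      (fun y : (Fin n → ℕ) × Finset (Fin n) => (sampledMin v y.2 - shift τ v : ℝ)),
      integral_fun_snd (fun D : Finset (Fin n) => (sampledMin v D - shift τ v : ℝ)),
      integral_sub Integrable.of_finite (integrable_const _)]
    simp
  · refine Finset.sum_congr rfl fun i _ => ?_
    rw [integral_const_mul, integral_fun_snd (fun y : (Fin n → ℕ) × Finset (Fin n) => (y.1 i : ℝ)),
      integral_fun_fst (fun y : Fin n → ℕ => (y i : ℝ))]
    simp [meanService]

end SlotLaw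

namespace IsPowerOfDSystem

variable {n d : ℕ} {α : Measure ℕ} {ν : Measure (Fin n → ℕ)} {Amax Smax : ℕ}
  {Ω : Type*} [mΩ : MeasurableSpace Ω] {P : Measure Ω}
  {ℱ : Filtration ℕ mΩ} {a : ℕ → Ω → ℕ} {s : ℕ → Ω → Fin n → ℕ} {D : ℕ → Ω → Finset (Fin n)}
  {r : ℕ → Ω → Fin n} {u q : ℕ → Ω → Fin n → ℕ}

theorem measurable_slot (h : IsPowerOfDSystem d α ν P ℱ a s D r u q) (k : ℕ) :
    Measurable fun ω => (a k ω, s k ω, D k ω) :=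
  ((h.measurable_arrival k).mono (ℱ.le _) le_rfl).prodMk
    (((h.measurable_service k).mono (ℱ.le _) le_rfl).prodMk
      ((h.measurable_sample k).mono (ℱ.le _) le_rfl))

theorem ae_isStep (h : IsPowerOfDSystem d α ν P ℱ a s D r u q) (hdn : d ≤ n)
    (hA : ∀ᵐ x ∂α, x ≤ Amax) (hS : ∀ᵐ y ∂ν, ∀ i, y i ≤ Smax) (k : ℕ) :
    ∀ᵐ ω ∂P, IsStep Amax Smax (q k ω) (q (k + 1) ω) (a k ω, s k ω, D k ω) (r k ω) (u k ω) := by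
  have h1 := ae_slotLaw hdn hA hS
  rw [slotLaw, sampleLaw, ← h.law k] at h1
  filter_upwards [ae_of_ae_map (h.measurable_slot k).aemeasurable h1, h.route_mem k, h.dynamics k,
    h.unused k] with ω h1 h2 h3 h4
  exact ⟨h1.1, h1.2, h2.1, h2.2, h3, h4⟩

variable [IsProbabilityMeasure P]

/-- Independence of the past, in the form of an integral over an event `B` of the past. -/
theorem setIntegral_slot (h : IsPowerOfDSystem d α ν P ℱ a s D r u q) (k : ℕ)
    {g : ℕ × (Fin n → ℕ) × Finset (Fin n) → ℝ} (hg : Integrable g (slotLaw d α ν))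
    {B : Set Ω} (hB : MeasurableSet[ℱ k] B) :
    Integrable (fun ω => g (a k ω, s k ω, D k ω)) P ∧
    ∫ ω in B, g (a k ω, s k ω, D k ω) ∂P = P.real B * ∫ p, g p ∂(slotLaw d α ν) := by
  have hm := h.measurable_slot k
  have hgm : Measurable g := Measurable.of_discrete
  have hint : Integrable (fun ω => g (a k ω, s k ω, D k ω)) P := by
    rw [slotLaw, sampleLaw, ← h.law k] at hg
    exact hg.comp_measurable hm
  refine ⟨hint, ?_⟩
  have hce := condExp_indep_eq hm.comap_le (ℱ.le k)
    (f := fun ω => g (a k ω, s k ω, D k ω))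
    (hgm.comp (comap_measurable _)).stronglyMeasurable (h.indep_past k)
  rw [← setIntegral_condExp (ℱ.le k) hint hB,
    setIntegral_congr_ae (ℱ.le k _ hB) (hce.mono fun ω hω _ => hω), setIntegral_const, smul_eq_mul,
    slotLaw, sampleLaw, ← h.law k, integral_map hm.aemeasurable hgm.aestronglyMeasurable]

end IsPowerOfDSystem

/-! ### Exponential moments -/

/-- The requirements on the exponent `θ` that turn a drift `-γ` of the Lyapunov function `V` into a
geometric drift of `e^(θ V)`. With `B = jumpBound` and `V` at least `secondOrder / γ`, the drift of `V`
is at most `-γ / 2`, so that `e^(θ V)` contracts by the factor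
`1 - θ γ / 2 + (θ B)² ≤ 1 - θ γ / 4`. -/
structure ExpRate (n Amax Smax : ℕ) (γ θ : ℝ) : Prop where
  gamma_pos : 0 < γ
  theta_pos : 0 < θ
  theta_jump_le : θ * jumpBound n Amax Smax ≤ 1
  theta_sq_le : (θ * jumpBound n Amax Smax) ^ 2 ≤ θ * γ / 4
  theta_gamma_le : θ * γ ≤ 1

theorem jumpBound_pos (n Amax Smax : ℕ) : 0 < jumpBound n Amax Smax := by
  unfold jumpBound; positivity

theorem exists_expRate (n Amax Smax : ℕ) {γ : ℝ} (hγ : 0 < γ) : ∃ θ, ExpRate n Amax Smax γ θ := by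
  have hB := jumpBound_pos n Amax Smax
  set B := jumpBound n Amax Smax
  have h1 : min (1 / B) (min (γ / (4 * B ^ 2)) (1 / γ)) ≤ 1 / B := min_le_left _ _
  have h2 : min (1 / B) (min (γ / (4 * B ^ 2)) (1 / γ)) ≤ γ / (4 * B ^ 2) :=
    (min_le_right _ _).trans (min_le_left _ _)
  have h3 : min (1 / B) (min (γ / (4 * B ^ 2)) (1 / γ)) ≤ 1 / γ :=
    (min_le_right _ _).trans (min_le_right _ _)
  have h0 : 0 < min (1 / B) (min (γ / (4 * B ^ 2)) (1 / γ)) := by positivity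
  refine ⟨_, hγ, h0, (le_div_iff₀ hB).mp h1, ?_, (le_div_iff₀ hγ).mp h3⟩
  generalize min (1 / B) (min (γ / (4 * B ^ 2)) (1 / γ)) = θ at *
  rw [le_div_iff₀ (by positivity)] at h2
  nlinarith

/-- The term `2 n Smax² + jumpBound²` of second order in the drift of the squared norm. -/
noncomputable def secondOrder (n Amax Smax : ℕ) : ℝ :=
  2 * n * Smax ^ 2 + jumpBound n Amax Smax ^ 2

/-- A bound on `e^(θ V)` after one slot that starts with `V < secondOrder / γ`, where the drift of `V`
may be positive. -/
noncomputable def expBound (n Amax Smax : ℕ) (γ θ : ℝ) : ℝ :=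
  Real.exp (θ * (secondOrder n Amax Smax / γ + jumpBound n Amax Smax))

theorem secondOrder_pos (n Amax Smax : ℕ) : 0 < secondOrder n Amax Smax := by
  have := jumpBound_pos n Amax Smax
  unfold secondOrder; positivity

namespace IsPowerOfDSystem

variable {n d : ℕ} {α : Measure ℕ} [IsProbabilityMeasure α] {ν : Measure (Fin n → ℕ)}
  [IsProbabilityMeasure ν] {Amax Smax : ℕ}
  {Ω : Type*} [mΩ : MeasurableSpace Ω] {P : Measure Ω} [IsProbabilityMeasure P]
  {ℱ : Filtration ℕ mΩ} {a : ℕ → Ω → ℕ} {s : ℕ → Ω → Fin n → ℕ} {D : ℕ → Ω → Finset (Fin n)}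
  {r : ℕ → Ω → Fin n} {u q : ℕ → Ω → Fin n → ℕ} {τ γ θ : ℝ}

/-- Geometric drift over an event of the past on which the queue lengths are a constant `v`. -/
theorem setLIntegral_exp_le_of_eq (h : IsPowerOfDSystem d α ν P ℱ a s D r u q) (hdn : d ≤ n)
    (hA : ∀ᵐ x ∂α, x ≤ Amax) (hS : ∀ᵐ y ∂ν, ∀ i, y i ≤ Smax) (hτ : τ * τ = τ) (hτ0 : 0 ≤ τ)
    (hθ : ExpRate n Amax Smax γ θ) {v : Fin n → ℕ}
    (hdrift : γ * lyapunov τ v ≤ ∑ i, (v i - shift τ v) * meanService ν i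
      - (∫ x, (x : ℝ) ∂α) * (∫ D, (sampledMin v D : ℝ) ∂(sampleLaw n d) - shift τ v))
    {k : ℕ} {B : Set Ω} (hB : MeasurableSet[ℱ k] B) (hBv : ∀ ω ∈ B, q k ω = v) :
    ∫⁻ ω in B, ENNReal.ofReal (Real.exp (θ * lyapunov τ (q (k + 1) ω))) ∂P
      ≤ ENNReal.ofReal ((1 - θ * γ / 4) * Real.exp (θ * lyapunov τ v) + expBound n Amax Smax γ θ)
        * P B := by
  have hBm : MeasurableSet B := ℱ.le k _ hB
  have hstep := h.ae_isStep hdn hA hS k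
  have hρ : 0 ≤ 1 - θ * γ / 4 := by linarith [hθ.theta_gamma_le]
  by_cases hV : lyapunov τ v < secondOrder n Amax Smax / γ
  · rw [← setLIntegral_const]
    refine setLIntegral_mono_ae' hBm ?_
    filter_upwards [hstep] with ω hω hωB
    rw [hBv ω hωB] at hω
    refine ENNReal.ofReal_le_ofReal ?_
    have h1 := (abs_le.mp (hω.abs_lyapunov_sub_le hτ)).2
    have h2 : Real.exp (θ * lyapunov τ (q (k + 1) ω)) ≤ expBound n Amax Smax γ θ :=
      Real.exp_le_exp.mpr (mul_le_mul_of_nonneg_left (by linarith) hθ.theta_pos.le)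
    have h3 : 0 ≤ (1 - θ * γ / 4) * Real.exp (θ * lyapunov τ v) :=
      mul_nonneg hρ (Real.exp_pos _).le
    linarith
  · rw [not_lt, div_le_iff₀ hθ.gamma_pos] at hV
    have hV0 : 0 < lyapunov τ v := by
      have := secondOrder_pos n Amax Smax
      have := hθ.gamma_pos
      by_contra! hc
      nlinarith
    obtain ⟨hi, hie⟩ := integrable_increment_and_integral hdn hA hS τ v
    set g : ℕ × (Fin n → ℕ) × Finset (Fin n) → ℝ := fun p => Real.exp (θ * lyapunov τ v) *
      (1 + θ * ((2 * increment τ v p + secondOrder n Amax Smax)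
        / (2 * lyapunov τ v)) + (θ * jumpBound n Amax Smax) ^ 2) with hg
    have := isProbabilityMeasure_sampleLaw hdn
    have hi1 : Integrable (fun p => θ * ((2 * increment τ v p + secondOrder n Amax Smax)
        / (2 * lyapunov τ v))) (slotLaw d α ν) :=
      (((hi.const_mul 2).add (integrable_const _)).div_const _).const_mul _
    have hgi : Integrable g (slotLaw d α ν) :=
      (((integrable_const _).add hi1).add (integrable_const _)).const_mul _
    have hgint : ∫ p, g p ∂(slotLaw d α ν) = Real.exp (θ * lyapunov τ v) *
      (1 + θ * ((2 * (∫ p, increment τ v p ∂(slotLaw d α ν)) + secondOrder n Amax Smax)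
        / (2 * lyapunov τ v)) + (θ * jumpBound n Amax Smax) ^ 2) := by
      have hi2 : Integrable (fun p => 1 + θ * ((2 * increment τ v p + secondOrder n Amax Smax)
          / (2 * lyapunov τ v))) (slotLaw d α ν) := (integrable_const _).add hi1
      rw [hg, integral_const_mul, integral_add hi2 (integrable_const _),
        integral_add (integrable_const _) hi1, integral_const_mul, integral_div,
        integral_add (hi.const_mul 2) (integrable_const _), integral_const_mul]
      simp
    have hgle : ∫ p, g p ∂(slotLaw d α ν) ≤ (1 - θ * γ / 4) * Real.exp (θ * lyapunov τ v) := by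
      rw [hgint, mul_comm (1 - _)]
      refine mul_le_mul_of_nonneg_left ?_ (Real.exp_pos _).le
      have h1 : (2 * (∫ p, increment τ v p ∂(slotLaw d α ν)) + secondOrder n Amax Smax)
          / (2 * lyapunov τ v) ≤ - (γ / 2) := by
        rw [div_le_iff₀ (by positivity), hie]
        linarith
      have h2 := mul_le_mul_of_nonneg_left h1 hθ.theta_pos.le
      linarith [hθ.theta_sq_le]
    obtain ⟨hgI, hgB⟩ := h.setIntegral_slot k hgi hB
    have hpt : ∀ᵐ ω ∂P, ω ∈ B → Real.exp (θ * lyapunov τ (q (k + 1) ω))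
        ≤ g (a k ω, s k ω, D k ω) := by
      filter_upwards [hstep] with ω hω hωB
      rw [hBv ω hωB] at hω
      exact hω.exp_lyapunov_le hτ hτ0 hθ.theta_pos.le hθ.theta_jump_le hV0
    calc ∫⁻ ω in B, ENNReal.ofReal (Real.exp (θ * lyapunov τ (q (k + 1) ω))) ∂P
        ≤ ∫⁻ ω in B, ENNReal.ofReal (g (a k ω, s k ω, D k ω)) ∂P :=
          setLIntegral_mono_ae' hBm (hpt.mono fun ω hω hωB => ENNReal.ofReal_le_ofReal (hω hωB))
      _ = ENNReal.ofReal (∫ ω in B, g (a k ω, s k ω, D k ω) ∂P) := by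
          refine (ofReal_integral_eq_lintegral_ofReal hgI.integrableOn ?_).symm
          exact (ae_restrict_iff' hBm).mpr
            (hpt.mono fun ω hω hωB => (Real.exp_pos _).le.trans (hω hωB))
      _ ≤ ENNReal.ofReal (((1 - θ * γ / 4) * Real.exp (θ * lyapunov τ v)
            + expBound n Amax Smax γ θ) * P.real B) := by
          rw [hgB, mul_comm]
          refine ENNReal.ofReal_le_ofReal (mul_le_mul_of_nonneg_right ?_ measureReal_nonneg)
          have : 0 < expBound n Amax Smax γ θ := Real.exp_pos _
          linarith
      _ = _ := by
          have : 0 < expBound n Amax Smax γ θ := Real.exp_pos _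
          rw [ENNReal.ofReal_mul (add_nonneg (mul_nonneg hρ (Real.exp_pos _).le) this.le),
            ofReal_measureReal]

/-- Geometric drift over an arbitrary event of the past, which is split by the countably many values
of the queue lengths. -/
theorem setLIntegral_exp_succ_le (h : IsPowerOfDSystem d α ν P ℱ a s D r u q) (hdn : d ≤ n)
    (hA : ∀ᵐ x ∂α, x ≤ Amax) (hS : ∀ᵐ y ∂ν, ∀ i, y i ≤ Smax) (hτ : τ * τ = τ) (hτ0 : 0 ≤ τ)
    (hθ : ExpRate n Amax Smax γ θ)
    (hdrift : ∀ v : Fin n → ℕ, γ * lyapunov τ v ≤ ∑ i, (v i - shift τ v) * meanService ν i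
      - (∫ x, (x : ℝ) ∂α) * (∫ D, (sampledMin v D : ℝ) ∂(sampleLaw n d) - shift τ v))
    {k : ℕ} {B : Set Ω} (hB : MeasurableSet[ℱ k] B) :
    ∫⁻ ω in B, ENNReal.ofReal (Real.exp (θ * lyapunov τ (q (k + 1) ω))) ∂P
      ≤ ENNReal.ofReal (1 - θ * γ / 4)
          * ∫⁻ ω in B, ENNReal.ofReal (Real.exp (θ * lyapunov τ (q k ω))) ∂P
        + ENNReal.ofReal (expBound n Amax Smax γ θ) := by
  have hρ : 0 ≤ 1 - θ * γ / 4 := by linarith [hθ.theta_gamma_le]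
  have hC : 0 < expBound n Amax Smax γ θ := Real.exp_pos _
  have hqm : Measurable (q k) := (h.measurable_queue k).mono (ℱ.le k) le_rfl
  set S : (Fin n → ℕ) → Set Ω := fun v => B ∩ q k ⁻¹' {v} with hSdef
  have hSm : ∀ v, MeasurableSet[ℱ k] (S v) := fun v =>
    hB.inter (h.measurable_queue k (measurableSet_singleton v))
  have hU : B = ⋃ v, S v := by
    ext ω; simp [hSdef]
  have hdisj : Pairwise (Function.onFun Disjoint S) := by
    intro v w hvw
    refine Set.disjoint_left.mpr fun ω hv hw => hvw ?_
    exact hv.2.symm.trans hw.2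
  have hdec : ∀ f : Ω → ENNReal, ∫⁻ ω in B, f ω ∂P = ∑' v, ∫⁻ ω in S v, f ω ∂P := by
    intro f
    conv_lhs => rw [hU]
    exact lintegral_iUnion (fun v => ℱ.le k _ (hSm v)) hdisj f
  have hmeas : Measurable fun ω => ENNReal.ofReal (Real.exp (θ * lyapunov τ (q k ω))) :=
    (Measurable.of_discrete (f := fun v : Fin n → ℕ =>
      ENNReal.ofReal (Real.exp (θ * lyapunov τ v)))).comp hqm
  calc ∫⁻ ω in B, ENNReal.ofReal (Real.exp (θ * lyapunov τ (q (k + 1) ω))) ∂P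
      ≤ ∫⁻ ω in B, (ENNReal.ofReal (1 - θ * γ / 4)
          * ENNReal.ofReal (Real.exp (θ * lyapunov τ (q k ω)))
            + ENNReal.ofReal (expBound n Amax Smax γ θ)) ∂P := by
        rw [hdec, hdec]
        refine ENNReal.tsum_le_tsum fun v => ?_
        refine (h.setLIntegral_exp_le_of_eq hdn hA hS hτ hτ0 hθ (hdrift v) (hSm v)
          fun ω hω => hω.2).trans (le_of_eq ?_)
        rw [← setLIntegral_const]
        refine setLIntegral_congr_fun (ℱ.le k _ (hSm v)) fun ω hω => ?_
        have hqv : q k ω = v := hω.2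
        simp only [hqv]
        rw [ENNReal.ofReal_add (mul_nonneg hρ (Real.exp_pos _).le) hC.le, ENNReal.ofReal_mul hρ]
    _ ≤ _ := by
        rw [lintegral_add_right _ measurable_const, lintegral_const_mul _ hmeas, setLIntegral_const]
        gcongr
        exact mul_le_of_le_one_right' prob_le_one

/-- The initial queue lengths need not have an exponential moment, hence the restriction to an event
on which they are bounded. Their influence dies out geometrically. -/
theorem setLIntegral_exp_le (h : IsPowerOfDSystem d α ν P ℱ a s D r u q) (hdn : d ≤ n)
    (hA : ∀ᵐ x ∂α, x ≤ Amax) (hS : ∀ᵐ y ∂ν, ∀ i, y i ≤ Smax) (hτ : τ * τ = τ) (hτ0 : 0 ≤ τ)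
    (hθ : ExpRate n Amax Smax γ θ)
    (hdrift : ∀ v : Fin n → ℕ, γ * lyapunov τ v ≤ ∑ i, (v i - shift τ v) * meanService ν i
      - (∫ x, (x : ℝ) ∂α) * (∫ D, (sampledMin v D : ℝ) ∂(sampleLaw n d) - shift τ v))
    (R : ℝ) (k : ℕ) :
    ∫⁻ ω in {ω | lyapunov τ (q 0 ω) ≤ R},
        ENNReal.ofReal (Real.exp (θ * lyapunov τ (q k ω))) ∂P
      ≤ ENNReal.ofReal ((1 - θ * γ / 4) ^ k * Real.exp (θ * R)
          + expBound n Amax Smax γ θ / (θ * γ / 4)) := by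
  have hθγ : 0 < θ * γ := mul_pos hθ.theta_pos hθ.gamma_pos
  have hρ : 0 ≤ 1 - θ * γ / 4 := by linarith [hθ.theta_gamma_le]
  have hC : 0 < expBound n Amax Smax γ θ := Real.exp_pos _
  have hB : MeasurableSet[ℱ 0] {ω | lyapunov τ (q 0 ω) ≤ R} :=
    h.measurable_queue 0 (t := {v | lyapunov τ v ≤ R}) MeasurableSet.of_discrete
  induction k with
  | zero =>
    calc ∫⁻ ω in {ω | lyapunov τ (q 0 ω) ≤ R},
          ENNReal.ofReal (Real.exp (θ * lyapunov τ (q 0 ω))) ∂P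
        ≤ ∫⁻ _ω in {ω | lyapunov τ (q 0 ω) ≤ R}, ENNReal.ofReal (Real.exp (θ * R)) ∂P := by
          refine setLIntegral_mono' (ℱ.le 0 _ hB) fun ω hω => ENNReal.ofReal_le_ofReal ?_
          exact Real.exp_le_exp.mpr (mul_le_mul_of_nonneg_left hω hθ.theta_pos.le)
      _ ≤ ENNReal.ofReal (Real.exp (θ * R)) := by
          rw [setLIntegral_const]
          exact mul_le_of_le_one_right' prob_le_one
      _ ≤ _ := by
          refine ENNReal.ofReal_le_ofReal ?_
          have : 0 < expBound n Amax Smax γ θ / (θ * γ / 4) := by positivity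
          simpa using this.le
  | succ k ih =>
    refine (h.setLIntegral_exp_succ_le hdn hA hS hτ hτ0 hθ hdrift
      (ℱ.mono (Nat.zero_le k) _ hB)).trans ?_
    calc _ ≤ ENNReal.ofReal (1 - θ * γ / 4) * ENNReal.ofReal ((1 - θ * γ / 4) ^ k * Real.exp (θ * R)
          + expBound n Amax Smax γ θ / (θ * γ / 4)) + ENNReal.ofReal (expBound n Amax Smax γ θ) := by
          gcongr
      _ = _ := by
          rw [← ENNReal.ofReal_mul hρ, ← ENNReal.ofReal_add (by positivity) hC.le]
          congr 1
          have := hθ.theta_pos.ne'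
          have := hθ.gamma_pos.ne'
          field_simp
          ring

/-- The exponential moment of the steady state. Truncating `e^(θ V)` at `L` makes it a bounded function,
whose mean passes to the limit; the event of initial queues above `R` then adds at most `L` times its
probability, which vanishes as `R → ∞`. -/
theorem lintegral_exp_limit_le (h : IsPowerOfDSystem d α ν P ℱ a s D r u q) (hdn : d ≤ n)
    (hA : ∀ᵐ x ∂α, x ≤ Amax) (hS : ∀ᵐ y ∂ν, ∀ i, y i ≤ Smax) (hτ : τ * τ = τ) (hτ0 : 0 ≤ τ)
    (hθ : ExpRate n Amax Smax γ θ)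
    (hdrift : ∀ v : Fin n → ℕ, γ * lyapunov τ v ≤ ∑ i, (v i - shift τ v) * meanService ν i
      - (∫ x, (x : ℝ) ∂α) * (∫ D, (sampledMin v D : ℝ) ∂(sampleLaw n d) - shift τ v))
    {Ω' : Type*} [MeasurableSpace Ω'] {P' : Measure Ω'} [IsProbabilityMeasure P']
    {qbar : Ω' → Fin n → ℕ} (hlim : TendstoInDistribution q atTop qbar (fun _ => P) P') :
    ∫⁻ ω, ENNReal.ofReal (Real.exp (θ * lyapunov τ (qbar ω))) ∂P'
      ≤ ENNReal.ofReal (expBound n Amax Smax γ θ / (θ * γ / 4)) := by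
  have hθγ : 0 < θ * γ := mul_pos hθ.theta_pos hθ.gamma_pos
  have hρ0 : 0 ≤ 1 - θ * γ / 4 := by linarith [hθ.theta_gamma_le]
  have hq0 : Measurable (q 0) := (h.measurable_queue 0).mono (ℱ.le 0) le_rfl
  set Φ : (Fin n → ℕ) → NNReal := fun v => (Real.exp (θ * lyapunov τ v)).toNNReal with hΦ
  have hΦe : ∀ v, ENNReal.ofReal (Real.exp (θ * lyapunov τ v)) = (Φ v : ENNReal) := fun v => rfl
  set C : ENNReal := ENNReal.ofReal (expBound n Amax Smax γ θ / (θ * γ / 4)) with hC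
  let f : ℕ → BoundedContinuousFunction (Fin n → ℕ) NNReal := fun L =>
    BoundedContinuousFunction.mkOfBound ⟨fun v => min (Φ v) L, continuous_of_discreteTopology⟩ L
      fun v w => by
        refine (NNReal.dist_eq _ _).trans_le (abs_sub_le_iff.mpr ⟨?_, ?_⟩) <;>
        · refine (sub_le_self _ (NNReal.coe_nonneg _)).trans ?_
          exact_mod_cast min_le_right _ _
  -- Truncation at level `L`, and restriction to the event that the initial queues are bounded.
  have h1 : ∀ L R k : ℕ, ∫⁻ ω, (f L (q k ω) : ENNReal) ∂P
      ≤ ENNReal.ofReal ((1 - θ * γ / 4) ^ k * Real.exp (θ * R)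
          + expBound n Amax Smax γ θ / (θ * γ / 4)) + L * P {ω | lyapunov τ (q 0 ω) ≤ R}ᶜ := by
    intro L R k
    have hB : MeasurableSet {ω | lyapunov τ (q 0 ω) ≤ R} :=
      hq0 (t := {v | lyapunov τ v ≤ R}) MeasurableSet.of_discrete
    rw [← lintegral_add_compl _ hB]
    refine add_le_add ((lintegral_mono fun ω => ?_).trans
      (h.setLIntegral_exp_le hdn hA hS hτ hτ0 hθ hdrift R k)) ?_
    · rw [hΦe]
      exact ENNReal.coe_le_coe.mpr (min_le_left _ _)
    · rw [← setLIntegral_const]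
      refine lintegral_mono fun ω => ?_
      exact (ENNReal.coe_le_coe.mpr (min_le_right _ (L : NNReal))).trans_eq (ENNReal.coe_natCast L)
  have h2 : ∀ L R : ℕ, ∫⁻ ω, (f L (qbar ω) : ENNReal) ∂P'
      ≤ C + L * P {ω | lyapunov τ (q 0 ω) ≤ R}ᶜ := by
    intro L R
    have ht := ProbabilityMeasure.tendsto_iff_forall_lintegral_tendsto.mp hlim.tendsto (f L)
    have hfm : Measurable fun v : Fin n → ℕ => (f L v : ENNReal) := Measurable.of_discrete
    simp only [ProbabilityMeasure.coe_mk] at ht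
    rw [lintegral_map' hfm.aemeasurable hlim.aemeasurable_limit] at ht
    have hpow : Tendsto (fun k : ℕ => (1 - θ * γ / 4) ^ k * Real.exp (θ * R)
        + expBound n Amax Smax γ θ / (θ * γ / 4)) atTop
        (𝓝 (0 * Real.exp (θ * R) + expBound n Amax Smax γ θ / (θ * γ / 4))) :=
      ((tendsto_pow_atTop_nhds_zero_of_lt_one hρ0 (by linarith)).mul_const _).add_const _
    rw [zero_mul, zero_add] at hpow
    refine le_of_tendsto_of_tendsto' ht
      ((ENNReal.tendsto_ofReal hpow).add_const (L * P {ω | lyapunov τ (q 0 ω) ≤ R}ᶜ)) fun k => ?_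
    rw [lintegral_map' hfm.aemeasurable (hlim.forall_aemeasurable k)]
    exact h1 L R k
  have h3 : Tendsto (fun R : ℕ => P {ω | lyapunov τ (q 0 ω) ≤ R}ᶜ) atTop (𝓝 0) := by
    have hI : ⋂ R : ℕ, {ω | lyapunov τ (q 0 ω) ≤ R}ᶜ = ∅ := by
      refine Set.eq_empty_of_forall_notMem fun ω hω => ?_
      obtain ⟨R, hR⟩ := exists_nat_ge (lyapunov τ (q 0 ω))
      exact Set.mem_iInter.mp hω R hR
    rw [← measure_empty (μ := P), ← hI]
    refine tendsto_measure_iInter_atTop (fun R => ?_) (fun R R' hRR' ω hω hω' => hω ?_)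
      ⟨0, measure_ne_top _ _⟩
    · exact (hq0 (t := {v | lyapunov τ v ≤ R}) MeasurableSet.of_discrete).compl.nullMeasurableSet
    · exact le_trans (α := ℝ) hω' (by exact_mod_cast hRR')
  have h4 : ∀ L : ℕ, ∫⁻ ω, (f L (qbar ω) : ENNReal) ∂P' ≤ C := by
    intro L
    have ht : Tendsto (fun R : ℕ => C + L * P {ω | lyapunov τ (q 0 ω) ≤ R}ᶜ) atTop
        (𝓝 (C + L * 0)) :=
      (ENNReal.Tendsto.const_mul h3 (Or.inr (ENNReal.natCast_ne_top L))).const_add C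
    rw [mul_zero, add_zero] at ht
    exact ge_of_tendsto' ht (h2 L)
  have h5 : ∀ ω, ENNReal.ofReal (Real.exp (θ * lyapunov τ (qbar ω)))
      = ⨆ L : ℕ, (f L (qbar ω) : ENNReal) := by
    intro ω
    rw [hΦe]
    refine le_antisymm ?_ (iSup_le fun L => ENNReal.coe_le_coe.mpr (min_le_left _ _))
    obtain ⟨L, hL⟩ := exists_nat_ge (Φ (qbar ω))
    refine le_iSup_of_le L (ENNReal.coe_le_coe.mpr ?_)
    exact le_min le_rfl hL
  simp_rw [h5]
  rw [lintegral_iSup' (fun L => ?_) (Eventually.of_forall fun ω L L' hLL' => ?_)]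
  · exact iSup_le h4
  · exact (Measurable.of_discrete (f := fun v : Fin n → ℕ =>
      (f L v : ENNReal))).comp_aemeasurable hlim.aemeasurable_limit
  · refine ENNReal.coe_le_coe.mpr (min_le_min_left _ ?_)
    exact_mod_cast hLL'

end IsPowerOfDSystem

/-! ### Moments of the steady state -/

/-- An exponential moment of `Y` bounds all the moments of a nonnegative `X ≤ Y`. -/
theorem integrable_pow_and_integral_le {Ω : Type*} [MeasurableSpace Ω] {P : Measure Ω}
    {X Y : Ω → ℝ} (hX : AEMeasurable X P) (hX0 : ∀ ω, 0 ≤ X ω) (hXY : ∀ ω, X ω ≤ Y ω)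
    {θ C : ℝ} (hθ : 0 < θ) (hC : 0 ≤ C)
    (hexp : ∫⁻ ω, ENNReal.ofReal (Real.exp (θ * Y ω)) ∂P ≤ ENNReal.ofReal C) (m : ℕ) :
    Integrable (fun ω => X ω ^ m) P ∧ ∫ ω, X ω ^ m ∂P ≤ m.factorial / θ ^ m * C := by
  have hpt : ∀ ω, X ω ^ m ≤ m.factorial / θ ^ m * Real.exp (θ * Y ω) := by
    intro ω
    have h1 : (θ * X ω) ^ m / m.factorial ≤ Real.exp (θ * X ω) :=
      Real.pow_div_factorial_le_exp _ (mul_nonneg hθ.le (hX0 ω)) m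
    have h2 : Real.exp (θ * X ω) ≤ Real.exp (θ * Y ω) :=
      Real.exp_le_exp.mpr (mul_le_mul_of_nonneg_left (hXY ω) hθ.le)
    have h3 := h1.trans h2
    rw [div_le_iff₀ (by positivity), mul_pow] at h3
    rw [div_mul_eq_mul_div, le_div_iff₀ (by positivity)]
    linarith
  have hle : ∫⁻ ω, ENNReal.ofReal (X ω ^ m) ∂P ≤ ENNReal.ofReal (m.factorial / θ ^ m * C) := by
    have hk : (0 : ℝ) ≤ m.factorial / θ ^ m := by positivity
    calc ∫⁻ ω, ENNReal.ofReal (X ω ^ m) ∂P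
        ≤ ∫⁻ ω, ENNReal.ofReal (m.factorial / θ ^ m) * ENNReal.ofReal (Real.exp (θ * Y ω)) ∂P := by
          refine lintegral_mono fun ω => ?_
          rw [← ENNReal.ofReal_mul hk]
          exact ENNReal.ofReal_le_ofReal (hpt ω)
      _ = ENNReal.ofReal (m.factorial / θ ^ m) * ∫⁻ ω, ENNReal.ofReal (Real.exp (θ * Y ω)) ∂P :=
          lintegral_const_mul' _ _ ENNReal.ofReal_ne_top
      _ ≤ _ := by
          rw [ENNReal.ofReal_mul hk]
          gcongr
  have hm : AEStronglyMeasurable (fun ω => X ω ^ m) P := (hX.pow_const m).aestronglyMeasurable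
  have h0 : 0 ≤ᵐ[P] fun ω => X ω ^ m := Eventually.of_forall fun ω => pow_nonneg (hX0 ω) m
  refine ⟨⟨hm, ?_⟩, ?_⟩
  · rw [hasFiniteIntegral_iff_ofReal h0]
    exact hle.trans_lt ENNReal.ofReal_lt_top
  · rw [integral_eq_lintegral_of_nonneg_ae h0 hm]
    exact ENNReal.toReal_le_of_le_ofReal (by positivity) hle

end LoadBalancing

theorem proposition1 {n d : ℕ} (hd : 2 ≤ d) (hdn : d ≤ n)
    (ν : Measure (Fin n → ℕ)) [IsProbabilityMeasure ν]
    (Smax : ℕ) (hS : ∀ᵐ y ∂ν, ∀ i, y i ≤ Smax) (Amax : ℕ)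
    (hμ : LoadBalancing.meanService ν ∈ interior (LoadBalancing.polytope n d))
    (δ : ℝ) (hδ : 0 < δ)
    (hslack : ∀ j : ℕ, d ≤ j → j < n →
      (j.choose d : ℝ) / (n.choose d : ℝ) ≤
        LoadBalancing.sumSmallest (LoadBalancing.meanService ν) j /
          (∑ i, LoadBalancing.meanService ν i) - δ) :
    ∃ M : ℕ → ℝ, ∀ ε : ℝ, 0 < ε → ε < ∑ i, LoadBalancing.meanService ν i →
      ε < δ * ∑ i, LoadBalancing.meanService ν i →
      ∀ (α : Measure ℕ) [IsProbabilityMeasure α], (∀ᵐ x ∂α, x ≤ Amax) →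
      (∫ x, (x : ℝ) ∂α) = (∑ i, LoadBalancing.meanService ν i) - ε →
      ∀ (Ω : Type*) [mΩ : MeasurableSpace Ω] (P : Measure Ω) [IsProbabilityMeasure P]
        (ℱ : Filtration ℕ mΩ) (a : ℕ → Ω → ℕ) (s : ℕ → Ω → Fin n → ℕ)
        (D : ℕ → Ω → Finset (Fin n)) (r : ℕ → Ω → Fin n) (u q : ℕ → Ω → Fin n → ℕ),
      LoadBalancing.IsPowerOfDSystem d α ν P ℱ a s D r u q →
      ∀ (Ω' : Type*) [MeasurableSpace Ω'] (P' : Measure Ω') [IsProbabilityMeasure P']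
        (qbar : Ω' → Fin n → ℕ),
      TendstoInDistribution q atTop qbar (fun _ => P) P' →
      ∀ m : ℕ, 1 ≤ m →
        Integrable (fun ω => ‖LoadBalancing.perp (LoadBalancing.toEuclid (qbar ω))‖ ^ m) P' ∧
        (∫ ω, ‖LoadBalancing.perp (LoadBalancing.toEuclid (qbar ω))‖ ^ m ∂P') ≤ M m := by
  have hn : 0 < n := by omega
  have hd0 : 0 < d := by omega
  obtain ⟨c, hc, hcap⟩ := LoadBalancing.exists_capacity_slack hn
    (LoadBalancing.pos_of_mem_interior_polytope hμ) hδ hslack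
  have hγ : 0 < c / (2 * n) := by positivity
  obtain ⟨θ, hθ⟩ := LoadBalancing.exists_expRate n Amax Smax hγ
  have hθγ : 0 < θ * (c / (2 * n)) := mul_pos hθ.theta_pos hγ
  refine ⟨fun m => m.factorial / θ ^ m *
    (LoadBalancing.expBound n Amax Smax (c / (2 * n)) θ / (θ * (c / (2 * n)) / 4)), ?_⟩
  intro ε hε _ _ α _ hA hmean Ω _ P _ ℱ a s D r u q hsys Ω' _ P' _ qbar hlim m _
  obtain ⟨τ, hτ⟩ : ∃ τ : ℝ, τ = 0 ∧ c / 2 ≤ ε ∨ τ = 1 ∧ ε ≤ c / 2 := by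
    rcases le_total (c / 2) ε with h | h
    · exact ⟨0, Or.inl ⟨rfl, h⟩⟩
    · exact ⟨1, Or.inr ⟨rfl, h⟩⟩
  have hτ01 : τ = 0 ∨ τ = 1 := hτ.imp And.left And.left
  have hdrift := fun v : Fin n → ℕ => LoadBalancing.mul_lyapunov_le_drift hd0 hdn hε.le hc
    (show ∑ i, LoadBalancing.meanService ν i = (∫ x, (x : ℝ) ∂α) + ε by rw [hmean]; ring)
    (hcap _ (by rw [hmean]; linarith)) hτ v
  have hexp := hsys.lintegral_exp_limit_le hdn hA hS
    (by rcases hτ01 with rfl | rfl <;> norm_num) (by rcases hτ01 with rfl | rfl <;> norm_num)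
    hθ hdrift hlim
  refine LoadBalancing.integrable_pow_and_integral_le ?_ (fun ω => norm_nonneg _)
    (fun ω => LoadBalancing.norm_perp_le_lyapunov hτ01 (qbar ω)) hθ.theta_pos
    (div_nonneg (Real.exp_pos _).le (by positivity)) hexp m
  exact (Measurable.of_discrete (f := fun v : Fin n → ℕ =>
    ‖LoadBalancing.perp (LoadBalancing.toEuclid v)‖)).comp_aemeasurable hlim.aemeasurable_limit
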